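/- **Theorem.** Every separable metric space is strongly paracompact. Let $(X,d)$ be a strongly paracompact metric space, i.e. every open cover of $X$ has an open refinement covering $X$ each of whose members meets only finitely many of its members. *Zero-dimensional sets.* Call $A\subseteq X$ zero-dimensional if $\dim A\le 0$ (every open cover of the subspace $A$ has a pairwise disjoint open refinement covering $A$); the theorem also holds verbatim if "zero-dimensional" is read throughout as $\operatorname{ind}A\le 0$ (the subspace $A$ has a base of clopen sets). In particular $\emptyset$ is zero-dimensional. $X$ is $\sigma$-zero-dimensional if it is the union of countably many zero-dimensional subsets. *Collections.* $\mathcal O$ is the collection of all open covers of $X$. $\mathcal O_{diam}$ is the collection of open covers $\mathcal U$ of $X$ for which there is a real $\varepsilon>0$ with $\operatorname{diam}U<\varepsilon$ for all $U\in\mathcal U$; the theorem also holds if $\mathcal O_{diam}$ is read as $\{\{U \text{ open}:\operatorname{diam}U<\varepsilon\}:\varepsilon>0\}$. $\mathcal O_Z$ is the collection of all open covers $\mathcal U$ of $X$ with $X\notin\mathcal U$ such that every zero-dimensional $A\subseteq X$ is contained in some $U\in\mathcal U$. $\mathcal N_Z$ is the collection of all families $\{U\subseteq X \text{ open}: A\subseteq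 U\}$ with $A\subseteq X$ zero-dimensional. $\neg\mathcal O$ is the complement of $\mathcal O$. *Games* (with innings $n=0,1,2,\dots$). In $G_1(\mathcal A,\mathcal B)$, ONE chooses $A_n\in\mathcal A$, TWO chooses $x_n\in A_n$, and TWO wins if $\{x_n:n\in\omega\}\in\mathcal B$. In $G_c(\mathcal A,\mathcal O)$, ONE chooses $\mathcal U_n\in\mathcal A$, TWO chooses a pairwise disjoint family $\mathcal V_n$ of open sets refining $\mathcal U_n$ (not necessarily covering $X$), and TWO wins if $\bigcup_n\mathcal V_n$ covers $X$. In the Haver game $H(X,d)$, ONE chooses a real $\varepsilon_n>0$, TWO chooses a pairwise disjoint family $\mathcal V_n$ of open sets of diameter less than $\varepsilon_n$, and TWO wins if $\bigcup_n\mathcal V_n$ covers $X$. ONE wins the plays that TWO does not win. A player wins a game if that player has a winning strategy (using all earlier moves of the opponent). A Markov strategy for TWO uses only the latest move of ONE and the inning number; a predetermined strategy for ONE uses only the inning number. Then the following are equivalent: 1. $X$ is $\sigma$-zero-dimensional. 2. TWO wins $H(X,d)$. 3. TWO wins $H(X,d)$ with a Markov strategy. 4. TWO wins $G_c(\mathcal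 O,\mathcal O)$. 5. TWO wins $G_c(\mathcal O,\mathcal O)$ with a Markov strategy. 6. TWO wins $G_c(\mathcal O_{diam},\mathcal O)$. 7. TWO wins $G_c(\mathcal O_{diam},\mathcal O)$ with a Markov strategy. 8. TWO wins $G_1(\mathcal O_Z,\mathcal O)$. 9. TWO wins $G_1(\mathcal O_Z,\mathcal O)$ with a Markov strategy. 10. ONE wins $G_1(\mathcal N_Z,\neg\mathcal O)$. 11. ONE wins $G_1(\mathcal N_Z,\neg\mathcal O)$ with a predetermined strategy. -/

import Mathlib

namespace TopGames

/-! ### Infinite two-player games -/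

/-- A game of length `ω`. In inning `n` player ONE chooses a legal move `m n ∈ moves`, and player
TWO answers with a legal reply `r n ∈ replies (m n)`. TWO wins the play if `twoWins r`, and ONE
wins it otherwise. -/
structure Game (M R : Type*) where
  moves : Set M
  replies : M → Set R
  twoWins : (ℕ → R) → Prop

/-- The list `[f 0, …, f (n - 1)]`. -/
def initial {α : Type*} (f : ℕ → α) (n : ℕ) : List α := (List.range n).map f

/-- TWO has a winning (perfect information) strategy: the reply in inning `n` depends on the moves
`m 0, …, m n` made by ONE so far. -/
def TwoWins {M R : Type*} (G : Game M R) : Prop :=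
  ∃ σ : List M → R, ∀ m : ℕ → M, (∀ n, m n ∈ G.moves) →
    (∀ n, σ (initial m (n + 1)) ∈ G.replies (m n)) ∧
      G.twoWins fun n => σ (initial m (n + 1))

/-- TWO has a winning Markov strategy: the reply in inning `n` depends only on the latest move
`m n` of ONE and on the number `n` of the inning. -/
def TwoWinsMarkov {M R : Type*} (G : Game M R) : Prop :=
  ∃ σ : M → ℕ → R, ∀ m : ℕ → M, (∀ n, m n ∈ G.moves) →
    (∀ n, σ (m n) n ∈ G.replies (m n)) ∧ G.twoWins fun n => σ (m n) n

/-- ONE has a winning (perfect information) strategy: the move in inning `n` depends on the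
replies `r 0, …, r (n - 1)` made by TWO so far. It has to be legal as long as TWO has replied
legally. -/
def OneWins {M R : Type*} (G : Game M R) : Prop :=
  ∃ σ : List R → M, ∀ r : ℕ → R,
    (∀ n, (∀ k < n, r k ∈ G.replies (σ (initial r k))) → σ (initial r n) ∈ G.moves) ∧
      ((∀ n, r n ∈ G.replies (σ (initial r n))) → ¬ G.twoWins r)

/-- ONE has a winning predetermined strategy: the move in inning `n` depends only on `n`. -/
def OneWinsPre {M R : Type*} (G : Game M R) : Prop :=
  ∃ σ : ℕ → M, (∀ n, σ n ∈ G.moves) ∧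
    ∀ r : ℕ → R, (∀ n, r n ∈ G.replies (σ n)) → ¬ G.twoWins r

/-- The selection game `G₁(𝒜, ℬ)`: in each inning ONE chooses `A ∈ 𝒜`, TWO chooses an element
of `A`, and TWO wins if the set of all chosen elements belongs to `ℬ`. -/
def G₁ {α : Type*} (𝒜 ℬ : Set (Set α)) : Game (Set α) α where
  moves := 𝒜
  replies A := A
  twoWins r := Set.range r ∈ ℬ

section Covers

variable (X : Type*) [TopologicalSpace X]

/-- The collection `𝒪` of all open covers of `X`. -/
def openCovers : Set (Set (Set X)) :=
  {𝒰 | (∀ U ∈ 𝒰, IsOpen U) ∧ ⋃₀ 𝒰 = Set.univ}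

/-- `𝒱` refines `𝒰`: each member of `𝒱` is contained in a member of `𝒰`
(`𝒱` need not be a cover). -/
def Refines {Y : Type*} (𝒱 𝒰 : Set (Set Y)) : Prop :=
  ∀ V ∈ 𝒱, ∃ U ∈ 𝒰, V ⊆ U

/-- The pairwise disjoint families of open subsets of `X`. -/
def disjointOpenFamilies : Set (Set (Set X)) :=
  {𝒱 | (∀ V ∈ 𝒱, IsOpen V) ∧ 𝒱.PairwiseDisjoint id}

/-- Every open cover of `X` has an open refinement that covers `X` and is star-finite, which means
that each of its members meets only finitely many of its members. (Used for Hausdorff spaces.) -/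
def StronglyParacompact : Prop :=
  ∀ 𝒰 ∈ openCovers X, ∃ 𝒱 ∈ openCovers X, Refines 𝒱 𝒰 ∧
    ∀ V ∈ 𝒱, {W ∈ 𝒱 | (V ∩ W).Nonempty}.Finite

/-- `dim X ≤ 0` for the covering dimension: every open cover of `X` has a pairwise disjoint open
refinement that covers `X`. -/
def CoveringZeroDim : Prop :=
  ∀ 𝒰 ∈ openCovers X, ∃ 𝒱 ∈ openCovers X, Refines 𝒱 𝒰 ∧ 𝒱.PairwiseDisjoint id

/-- The subsets `A` of `X` with `dim A ≤ 0` (covering dimension of the subspace `A`). -/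
def zeroDimSets : Set (Set X) := {A | CoveringZeroDim A}

/-- The subsets `A` of `X` with `ind A ≤ 0` (small inductive dimension of the subspace `A`). -/
def zeroIndSets : Set (Set X) := {A | HasSmallInductiveDimensionLE A 0}

variable {X}

/-- `X` is `σ`-`𝒵`: it is the union of countably many members of `𝒵`. -/
def IsSigma (𝒵 : Set (Set X)) : Prop :=
  ∃ Z : ℕ → Set X, (∀ n, Z n ∈ 𝒵) ∧ ⋃ n, Z n = Set.univ

/-- The collection `𝒪[𝒵]` of all non-trivial open covers `𝒰` of `X` (that is, `X ∉ 𝒰`) such that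
each member of `𝒵` is contained in a member of `𝒰`. -/
def coversOf (𝒵 : Set (Set X)) : Set (Set (Set X)) :=
  {𝒰 ∈ openCovers X | Set.univ ∉ 𝒰 ∧ ∀ A ∈ 𝒵, ∃ U ∈ 𝒰, A ⊆ U}

/-- The collection `𝒩[𝒵]` of the families `{U open : A ⊆ U}` for `A ∈ 𝒵`. -/
def nbhdsOf (𝒵 : Set (Set X)) : Set (Set (Set X)) :=
  {𝒩 | ∃ A ∈ 𝒵, 𝒩 = {U | IsOpen U ∧ A ⊆ U}}

/-- The game `G_c(𝒜, 𝒪)` on `X`: in each inning ONE chooses `𝒰 ∈ 𝒜`, TWO chooses a pairwise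
disjoint family of open sets that refines `𝒰`, and TWO wins if the chosen families together
cover `X`. -/
def Gc (𝒜 : Set (Set (Set X))) : Game (Set (Set X)) (Set (Set X)) where
  moves := 𝒜
  replies 𝒰 := {𝒱 ∈ disjointOpenFamilies X | Refines 𝒱 𝒰}
  twoWins r := (⋃ n, r n) ∈ openCovers X

end Covers

section Metric

variable (X : Type*) [MetricSpace X]

/-- The Haver game on the metric space `X`: in each inning ONE chooses a real `ε > 0`, TWO chooses
a pairwise disjoint family of open sets of diameter less than `ε`, and TWO wins if the chosen
families together cover `X`. -/
def haverGame : Game ℝ (Set (Set X)) where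
  moves := {ε | 0 < ε}
  replies ε := {𝒱 ∈ disjointOpenFamilies X | ∀ V ∈ 𝒱, Metric.ediam V < ENNReal.ofReal ε}
  twoWins r := (⋃ n, r n) ∈ openCovers X

/-- The covers `{U open : diam U < ε}` for real `ε > 0`. -/
def fullDiamCovers : Set (Set (Set X)) :=
  {𝒰 | ∃ ε : ℝ, 0 < ε ∧ 𝒰 = {U : Set X | IsOpen U ∧ Metric.ediam U < ENNReal.ofReal ε}}

/-- The open covers whose members all have diameter less than some real `ε > 0`. -/
def diamCovers : Set (Set (Set X)) :=
  {𝒰 ∈ openCovers X | ∃ ε : ℝ, 0 < ε ∧ ∀ U ∈ 𝒰, Metric.ediam U < ENNReal.ofReal ε}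

end Metric

end TopGames

/-! If `X` is the union of zero-dimensional sets `Z n`, inning `n` can be devoted to `Z n`. In `Gc`,
TWO covers `Z n` by a disjoint open refinement of the given cover
(`exists_disjointOpenFamily_of_mem_zeroDimSets`); in `G₁` on covers, TWO picks a member containing
`Z n`; in the dual game, ONE offers the neighbourhoods of `Z n`. Only the inning number and the
latest move matter.

Conversely, a winning strategy yields at each position a zero-dimensional set and countably many
continuations such that each point outside the set is missed by the answer to one of them. The tree
of these continuations is countable. A point outside all the sets attached to its nodes could be
missed forever along a branch, so these sets cover `X` (`isSigma_or_exists_play`). They are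
intersections of unions of disjoint open families with diameters tending to zero, hence have `ind ≤
0` (`iInter_sUnion_mem_zeroIndSets`).

Covering the `Z n` needs `dim ≤ 0`, while the converse produces `ind ≤ 0`. Strong paracompactness
makes the two agree on all subspaces, through `CountablyStratified`. -/

namespace TopGames

open Set Topology

/-! ### Zero-dimensional spaces -/

section ZeroDim

/-- A member of a pairwise disjoint open cover is clopen. -/
theorem isClopen_of_pairwiseDisjoint_cover {Y : Type*} [TopologicalSpace Y] {𝒱 : Set (Set Y)}
    (hO : ∀ V ∈ 𝒱, IsOpen V) (hd : 𝒱.PairwiseDisjoint id) (hc : ⋃₀ 𝒱 = univ) {V : Set Y}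
    (hV : V ∈ 𝒱) : IsClopen V := by
  refine ⟨⟨?_⟩, hO V hV⟩
  have : Vᶜ = ⋃₀ (𝒱 \ {V}) := by
    ext y
    constructor
    · intro hy
      obtain ⟨W, hW, hyW⟩ : y ∈ ⋃₀ 𝒱 := hc ▸ mem_univ y
      exact ⟨W, ⟨hW, fun h => hy (h ▸ hyW)⟩, hyW⟩
    · rintro ⟨W, ⟨hW, hne⟩, hyW⟩ hyV
      exact disjoint_left.1 (hd hW hV hne) hyW hyV
  rw [this]
  exact isOpen_sUnion fun W hW => hO W hW.1

theorem hasSmallInductiveDimensionLE_zero_of_nhds {Y : Type*} [TopologicalSpace Y]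
    (h : ∀ (y : Y) (U : Set Y), y ∈ U → IsOpen U → ∃ V, IsClopen V ∧ y ∈ V ∧ V ⊆ U) :
    HasSmallInductiveDimensionLE Y 0 :=
  hasSmallInductiveDimensionLT_one_iff.2 <|
    TopologicalSpace.isTopologicalBasis_of_isOpen_of_nhds (fun _ hU => hU.isOpen) h

theorem CoveringZeroDim.hasSmallInductiveDimensionLE {Y : Type*} [TopologicalSpace Y] [T1Space Y]
    (h : CoveringZeroDim Y) : HasSmallInductiveDimensionLE Y 0 := by
  refine hasSmallInductiveDimensionLE_zero_of_nhds fun y U hy hU => ?_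
  -- In any refinement of this cover, a member containing `y` can only lie in `U`.
  obtain ⟨𝒱, ⟨hO, hc⟩, hr, hd⟩ := h {U, {y}ᶜ} ⟨by
    rintro W (rfl | rfl)
    exacts [hU, isOpen_compl_singleton], by
    refine eq_univ_of_forall fun z => ?_
    by_cases hz : z = y
    · exact ⟨U, Or.inl rfl, hz ▸ hy⟩
    · exact ⟨{y}ᶜ, Or.inr rfl, hz⟩⟩
  obtain ⟨V, hV, hyV⟩ : y ∈ ⋃₀ 𝒱 := hc ▸ mem_univ y
  refine ⟨V, isClopen_of_pairwiseDisjoint_cover hO hd hc hV, hyV, ?_⟩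
  obtain ⟨W, rfl | rfl, hW⟩ := hr V hV
  · exact hW
  · exact absurd rfl (hW hyV)

/-- For each `ε > 0` there is a locally constant map assigning to each point `x` a countable family
of sets of diameter less than `ε` that covers `x`. -/
def CountablyStratified (Y : Type*) [MetricSpace Y] : Prop :=
  ∀ ε : ℝ, 0 < ε → ∃ c : Y → Set (Set Y), IsLocallyConstant c ∧
    ∀ x, (c x).Countable ∧ (∀ W ∈ c x, Metric.ediam W < ENNReal.ofReal ε) ∧ x ∈ ⋃₀ c x

/-- Restriction and traces suffice. This inheritance by arbitrary subspaces is the reason for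
working with stratifications instead of star-finite refinements. -/
theorem CountablyStratified.subspace {Y : Type*} [MetricSpace Y] (h : CountablyStratified Y)
    (A : Set Y) : CountablyStratified A := by
  intro ε hε
  obtain ⟨c, hc, h⟩ := h ε hε
  refine ⟨fun a => (fun W => Subtype.val ⁻¹' W) '' c a,
    (hc.comp_continuous continuous_subtype_val).comp (fun s => (fun W => Subtype.val ⁻¹' W) '' s),
    fun a => ⟨(h a).1.image _, ?_, ?_⟩⟩
  · rintro _ ⟨W, hW, rfl⟩
    refine lt_of_le_of_lt ?_ ((h a).2.1 W hW)
    exact Metric.ediam_le fun x hx y hy => Metric.edist_le_ediam_of_mem (s := W) hx hy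
  · obtain ⟨W, hW, ha⟩ := (h a).2.2
    exact ⟨_, ⟨W, hW, rfl⟩, ha⟩

theorem exists_isOpen_ediam_lt {Y : Type*} [MetricSpace Y] (x : Y) {ε : ℝ} (hε : 0 < ε) :
    ∃ U : Set Y, IsOpen U ∧ x ∈ U ∧ Metric.ediam U < ENNReal.ofReal ε := by
  refine ⟨Metric.ball x (ε / 4), Metric.isOpen_ball, Metric.mem_ball_self (by linarith), ?_⟩
  refine lt_of_le_of_lt (Metric.ediam_le_of_forall_dist_le (C := ε / 2) fun y hy z hz => ?_)
    ((ENNReal.ofReal_lt_ofReal_iff hε).2 (by linarith))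
  have h1 := Metric.mem_ball.1 hy
  have h2 := Metric.mem_ball'.1 hz
  linarith [dist_triangle y x z]

theorem countable_setOf_reflTransGen {α : Type*} {r : α → α → Prop}
    (h : ∀ a, {b | r a b}.Countable) (a : α) : {b | Relation.ReflTransGen r a b}.Countable := by
  let f : ℕ → Set α := fun n => Nat.rec {a} (fun _ s => ⋃ b ∈ s, {c | r b c}) n
  have hf : ∀ n, (f n).Countable := fun n => by
    induction n with
    | zero => exact countable_singleton a
    | succ n ih => exact ih.biUnion fun b _ => h b
  refine (countable_iUnion hf).mono fun b hb => ?_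
  induction hb with
  | refl => exact mem_iUnion.2 ⟨0, rfl⟩
  | tail _ hbc ih =>
    obtain ⟨n, hn⟩ := mem_iUnion.1 ih
    exact mem_iUnion.2 ⟨n + 1, mem_biUnion hn hbc⟩

/-- In a star-finite cover by small sets, each chain component is countable. All members containing
a given point meet each other, so the component depends only on the point and is constant on each
member. -/
theorem StronglyParacompact.countablyStratified {X : Type*} [MetricSpace X]
    (h : StronglyParacompact X) : CountablyStratified X := by
  intro ε hε
  obtain ⟨𝒱, ⟨hO, hc⟩, hr, hs⟩ := h {U | IsOpen U ∧ Metric.ediam U < ENNReal.ofReal ε}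
    ⟨fun U hU => hU.1, eq_univ_of_forall fun x => by
      obtain ⟨U, hU, hx, hd⟩ := exists_isOpen_ediam_lt x hε
      exact ⟨U, ⟨hU, hd⟩, hx⟩⟩
  let r : Set X → Set X → Prop := fun V W => V ∈ 𝒱 ∧ W ∈ 𝒱 ∧ (V ∩ W).Nonempty
  have hcov : ∀ x, ∃ V ∈ 𝒱, x ∈ V := fun x => by
    have : x ∈ ⋃₀ 𝒱 := hc ▸ mem_univ x
    exact this
  let c : X → Set (Set X) := fun x => {W | ∃ V ∈ 𝒱, x ∈ V ∧ Relation.ReflTransGen r V W}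
  have hsub : ∀ V ∈ 𝒱, ∀ x ∈ V, ∀ y ∈ V, c x ⊆ c y := by
    rintro V hV x hx y hy W ⟨V', hV', hxV', hW⟩
    exact ⟨V, hV, hy, .head ⟨hV, hV', x, hx, hxV'⟩ hW⟩
  refine ⟨c, (IsLocallyConstant.iff_exists_open c).2 fun x => ?_, fun x => ⟨?_, ?_, ?_⟩⟩
  · obtain ⟨V, hV, hx⟩ := hcov x
    exact ⟨V, hO V hV, hx, fun y hy => (hsub V hV y hy x hx).antisymm (hsub V hV x hx y hy)⟩
  · obtain ⟨V, hV, hx⟩ := hcov x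
    refine (countable_setOf_reflTransGen (r := r) (fun W => ?_) V).mono ?_
    · by_cases hW : W ∈ 𝒱
      · exact ((hs W hW).subset fun W' hW' => ⟨hW'.2.1, hW'.2.2⟩).countable
      · exact countable_empty.mono fun W' hW' => hW hW'.1
    · rintro W ⟨V', hV', hxV', hW⟩
      exact .head ⟨hV, hV', x, hx, hxV'⟩ hW
  · rintro W ⟨V, hV, -, hW⟩
    have hW𝒱 : W ∈ 𝒱 := by
      rcases hW.cases_tail with rfl | ⟨_, _, h⟩
      exacts [hV, h.2.1]
    obtain ⟨U, hU, hWU⟩ := hr W hW𝒱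
    exact (Metric.ediam_mono hWU).trans_lt hU.2
  · obtain ⟨V, hV, hx⟩ := hcov x
    exact ⟨V, ⟨V, hV, hx, .refl⟩, hx⟩

theorem isClopen_setOf_mem_of_isLocallyConstant {Y ι : Type*} [TopologicalSpace Y] {f : Y → ι}
    (hf : IsLocallyConstant f) {K : ι → Set Y} (hK : ∀ i, IsClopen (K i)) :
    IsClopen {x | x ∈ K (f x)} := by
  have key : ∀ L : ι → Set Y, (∀ i, IsOpen (L i)) → IsOpen {x | x ∈ L (f x)} := by
    intro L hL
    refine isOpen_iff_mem_nhds.2 fun x hx => ?_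
    filter_upwards [(IsLocallyConstant.iff_eventually_eq f).1 hf x, (hL (f x)).mem_nhds hx]
      with y hy hyL
    exact hy ▸ hyL
  exact ⟨⟨key (fun i => (K i)ᶜ) fun i => (hK i).compl.isOpen⟩, key K fun i => (hK i).isOpen⟩

theorem exists_nat_forall_ediam_lt_subset {Y : Type*} [MetricSpace Y] {x : Y} {U : Set Y}
    (hU : IsOpen U) (hx : x ∈ U) :
    ∃ n : ℕ, ∀ W : Set Y, x ∈ W → Metric.ediam W < ENNReal.ofReal (1 / (n + 1)) → W ⊆ U := by
  obtain ⟨ε, hε, hb⟩ := Metric.isOpen_iff.1 hU x hx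
  obtain ⟨n, hn⟩ := exists_nat_one_div_lt hε
  refine ⟨n, fun W hxW hW y hy => hb ?_⟩
  have := (Metric.edist_le_ediam_of_mem hy hxW).trans_lt hW
  rw [edist_dist, ENNReal.ofReal_lt_ofReal_iff (by positivity)] at this
  exact this.trans hn

/-- In a countably stratified metric space small inductive dimension zero implies covering
dimension zero. -/
theorem CountablyStratified.coveringZeroDim {Y : Type*} [MetricSpace Y]
    (hY : CountablyStratified Y) (h : HasSmallInductiveDimensionLE Y 0) : CoveringZeroDim Y := by
  classical
  rintro 𝒰 ⟨hO, hc⟩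
  have hbase := hasSmallInductiveDimensionLT_one_iff.1 h
  choose c hcl hcc using fun n : ℕ => hY (1 / (n + 1)) (by positivity)
  -- The enumeration is a function of the family alone, so the `i`-th set listed for `c n x` is
  -- again locally constant in `x`.
  have henum : ∀ s : Set (Set Y), ∃ e : ℕ → Set Y, s.Countable → s ⊆ range e := by
    intro s
    by_cases hs : s.Countable ∧ s.Nonempty
    · obtain ⟨e, he⟩ := hs.1.exists_eq_range hs.2
      exact ⟨e, fun _ => he.subset⟩
    · refine ⟨fun _ => ∅, fun h x hx => absurd ⟨h, x, hx⟩ hs⟩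
  choose enum henum using henum
  have hK : ∀ W : Set Y, ∃ K : Set Y, IsClopen K ∧ (K.Nonempty → ∃ U ∈ 𝒰, K ⊆ U) ∧
      ∀ K', IsClopen K' → W ⊆ K' → (∃ U ∈ 𝒰, K' ⊆ U) → W ⊆ K := by
    intro W
    by_cases hW : ∃ K', IsClopen K' ∧ W ⊆ K' ∧ ∃ U ∈ 𝒰, K' ⊆ U
    · obtain ⟨K, h1, h2, h3⟩ := hW
      exact ⟨K, h1, fun _ => h3, fun _ _ _ _ => h2⟩
    · exact ⟨∅, isClopen_empty, fun h => (not_nonempty_empty h).elim,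
        fun K' h1 h2 h3 => absurd ⟨K', h1, h2, h3⟩ hW⟩
  choose K hKc hKU hKW using hK
  let f : ℕ → Y → Set Y := fun j x => enum (c j.unpair.1 x) j.unpair.2
  have hf : ∀ j, IsLocallyConstant (f j) := fun j =>
    (hcl j.unpair.1).comp fun s => enum s j.unpair.2
  let E : ℕ → Set Y := fun j => {x | x ∈ K (f j x)}
  have hE : ∀ j, IsClopen (E j) := fun j => isClopen_setOf_mem_of_isLocallyConstant (hf j) hKc
  have hcover : ⋃ j, E j = univ := by
    refine eq_univ_of_forall fun x => ?_
    obtain ⟨U, hU, hxU⟩ : x ∈ ⋃₀ 𝒰 := hc ▸ mem_univ x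
    obtain ⟨K', hK', hxK', hK'U⟩ := hbase.exists_subset_of_mem_open hxU (hO U hU)
    obtain ⟨n, hn⟩ := exists_nat_forall_ediam_lt_subset hK'.isOpen hxK'
    obtain ⟨hcount, hdiam, W, hW, hxW⟩ := hcc n x
    obtain ⟨i, hi⟩ := henum _ hcount hW
    refine mem_iUnion.2 ⟨Nat.pair n i, ?_⟩
    have hfx : f (Nat.pair n i) x = W := by simp [f, hi]
    change x ∈ K (f (Nat.pair n i) x)
    rw [hfx]
    exact hKW W K' hK' (hn W hxW (hdiam W hW)) ⟨U, hU, hK'U⟩ hxW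
  have hD : ∀ j, IsOpen (disjointed E j) := fun j =>
    (disjointedRec (p := IsClopen) (fun t i ht => ht.diff (hE i)) (hE j)).isOpen
  -- `E j` may spread over many members of `𝒰`, but on a fibre of `f j` it agrees with a single `K
  -- W`, which lies in one member. Fibres are open and disjoint.
  refine ⟨{V | ∃ j, ∃ x ∈ disjointed E j, V = disjointed E j ∩ f j ⁻¹' {f j x}}, ⟨?_, ?_⟩, ?_, ?_⟩
  · rintro _ ⟨j, x, -, rfl⟩
    exact (hD j).inter ((hf j).isOpen_fiber _)
  · refine eq_univ_of_forall fun x => ?_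
    obtain ⟨j, hj⟩ := mem_iUnion.1 ((iUnion_disjointed.trans hcover).symm ▸ mem_univ x :
      x ∈ ⋃ j, disjointed E j)
    exact ⟨_, ⟨j, x, hj, rfl⟩, hj, rfl⟩
  · rintro _ ⟨j, x, hx, rfl⟩
    have hxE : x ∈ K (f j x) := disjointed_subset E j hx
    obtain ⟨U, hU, hKU⟩ := hKU _ ⟨x, hxE⟩
    refine ⟨U, hU, fun y hy => hKU ?_⟩
    have hyE : y ∈ K (f j y) := disjointed_subset E j hy.1
    exact (hy.2 : f j y = f j x) ▸ hyE
  · rintro _ ⟨j, x, hx, rfl⟩ _ ⟨k, y, hy, rfl⟩ hne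
    refine disjoint_left.2 fun z hz hz' => hne ?_
    have hjk : j = k := by
      by_contra hjk
      exact disjoint_left.1 (disjoint_disjointed E hjk) hz.1 hz'.1
    subst hjk
    rw [← (hz.2 : f j z = f j x), ← (hz'.2 : f j z = f j y)]

theorem StronglyParacompact.zeroDimSets_eq_zeroIndSets {X : Type*} [MetricSpace X]
    (h : StronglyParacompact X) : zeroDimSets X = zeroIndSets X :=
  Subset.antisymm (fun _ hA => CoveringZeroDim.hasSmallInductiveDimensionLE hA)
    fun A hA => (h.countablyStratified.subspace A).coveringZeroDim hA

/-- A subset of covering dimension zero can be covered by a pairwise disjoint family of open sets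
of the ambient space that refines a given open cover. -/
theorem exists_disjointOpenFamily_of_mem_zeroDimSets {X : Type*} [MetricSpace X] {A : Set X}
    (hA : A ∈ zeroDimSets X) {𝒰 : Set (Set X)} (h𝒰 : 𝒰 ∈ openCovers X) :
    ∃ 𝒱 ∈ disjointOpenFamilies X, Refines 𝒱 𝒰 ∧ A ⊆ ⋃₀ 𝒱 := by
  obtain ⟨𝒲, ⟨hO, hc⟩, hr, hd⟩ := hA ((fun U => Subtype.val ⁻¹' U) '' 𝒰) ⟨by
    rintro _ ⟨U, hU, rfl⟩
    exact (h𝒰.1 U hU).preimage continuous_subtype_val, by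
    refine eq_univ_of_forall fun a => ?_
    obtain ⟨U, hU, ha⟩ : (a : X) ∈ ⋃₀ 𝒰 := h𝒰.2 ▸ mem_univ _
    exact ⟨_, ⟨U, hU, rfl⟩, ha⟩⟩
  have hr' : ∀ W ∈ 𝒲, ∃ U ∈ 𝒰, W ⊆ Subtype.val ⁻¹' U := fun W hW => by
    obtain ⟨_, ⟨U, hU, rfl⟩, h⟩ := hr W hW
    exact ⟨U, hU, h⟩
  choose! u hu hWu using hr'
  -- Points closer to `W` than to the rest of `A`: since disjoint sets lie in each other's
  -- complements, two such strict inequalities contradict each other.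
  let E : Set A → Set X := fun W => u W ∩ {x | Metric.infEDist x (Subtype.val '' W) <
    Metric.infEDist x (Subtype.val '' Wᶜ)}
  refine ⟨E '' 𝒲, ⟨?_, ?_⟩, ?_, ?_⟩
  · rintro _ ⟨W, hW, rfl⟩
    exact (h𝒰.1 _ (hu W hW)).inter
      (isOpen_lt Metric.continuous_infEDist Metric.continuous_infEDist)
  · rintro _ ⟨W, hW, rfl⟩ _ ⟨W', hW', rfl⟩ hne
    refine disjoint_left.2 fun x hx hx' => ?_
    have hdis : Disjoint W W' := hd hW hW' fun h => hne (h ▸ rfl)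
    have h1 : Metric.infEDist x (Subtype.val '' Wᶜ) ≤ Metric.infEDist x (Subtype.val '' W') :=
      Metric.infEDist_anti (image_mono hdis.subset_compl_left)
    have h2 : Metric.infEDist x (Subtype.val '' W'ᶜ) ≤ Metric.infEDist x (Subtype.val '' W) :=
      Metric.infEDist_anti (image_mono hdis.subset_compl_right)
    exact lt_irrefl _ (((hx.2.trans_le h1).trans hx'.2).trans_le h2)
  · rintro _ ⟨W, hW, rfl⟩
    exact ⟨u W, hu W hW, inter_subset_left⟩
  · intro a ha
    obtain ⟨W, hW, haW⟩ : (⟨a, ha⟩ : A) ∈ ⋃₀ 𝒲 := hc ▸ mem_univ _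
    refine ⟨E W, ⟨W, hW, rfl⟩, hWu W hW haW, ?_⟩
    change Metric.infEDist a _ < Metric.infEDist a _
    rw [Metric.infEDist_zero_of_mem (mem_image_of_mem Subtype.val haW), Metric.infEDist_pos_iff_notMem_closure]
    intro hcl
    have : (⟨a, ha⟩ : A) ∈ closure Wᶜ := by
      rw [closure_subtype]
      exact hcl
    rw [(hO W hW).isClosed_compl.closure_eq] at this
    exact this haW

/-- If the diameters of disjoint open families `𝒱 n` tend to zero, then the set of the points
covered by all of them has small inductive dimension zero. -/
theorem iInter_sUnion_mem_zeroIndSets {X : Type*} [MetricSpace X] {𝒱 : ℕ → Set (Set X)}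
    (h𝒱 : ∀ n, 𝒱 n ∈ disjointOpenFamilies X)
    (hd : ∀ n, ∀ V ∈ 𝒱 n, Metric.ediam V < ENNReal.ofReal (1 / (n + 1))) :
    ⋂ n, ⋃₀ 𝒱 n ∈ zeroIndSets X := by
  refine hasSmallInductiveDimensionLE_zero_of_nhds fun y U hy hU => ?_
  obtain ⟨U', hU', rfl⟩ := isOpen_induced_iff.1 hU
  obtain ⟨n, hn⟩ := exists_nat_forall_ediam_lt_subset hU' hy
  obtain ⟨V, hV, hyV⟩ := mem_iInter.1 y.2 n
  refine ⟨Subtype.val ⁻¹' V, isClopen_of_pairwiseDisjoint_cover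
    (𝒱 := (fun V => Subtype.val ⁻¹' V) '' 𝒱 n) ?_ ?_ ?_ ⟨V, hV, rfl⟩, hyV,
    preimage_mono (hn V hyV (hd n V hV))⟩
  · rintro _ ⟨W, hW, rfl⟩
    exact ((h𝒱 n).1 W hW).preimage continuous_subtype_val
  · rintro _ ⟨W, hW, rfl⟩ _ ⟨W', hW', rfl⟩ hne
    exact ((h𝒱 n).2 hW hW' fun h => hne (h ▸ rfl)).preimage _
  · refine eq_univ_of_forall fun z => ?_
    obtain ⟨W, hW, hz⟩ := mem_iInter.1 z.2 n
    exact ⟨_, ⟨W, hW, rfl⟩, hz⟩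

/-- Each subset of covering dimension zero is contained in a `Gδ` set of small inductive dimension
zero. -/
theorem exists_iInter_mem_zeroIndSets {X : Type*} [MetricSpace X] {A : Set X}
    (hA : A ∈ zeroDimSets X) :
    ∃ U : ℕ → Set X, (∀ n, IsOpen (U n) ∧ A ⊆ U n) ∧ ⋂ n, U n ∈ zeroIndSets X := by
  have h : ∀ n : ℕ, {U : Set X | IsOpen U ∧ Metric.ediam U < ENNReal.ofReal (1 / (n + 1))} ∈
      openCovers X := fun n => ⟨fun U hU => hU.1, eq_univ_of_forall fun x => by
    obtain ⟨U, hU, hx, hd⟩ := exists_isOpen_ediam_lt x (ε := 1 / ((n : ℝ) + 1)) (by positivity)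
    exact ⟨U, ⟨hU, hd⟩, hx⟩⟩
  choose 𝒱 h𝒱 hr hA𝒱 using fun n => exists_disjointOpenFamily_of_mem_zeroDimSets hA (h n)
  refine ⟨fun n => ⋃₀ 𝒱 n, fun n => ⟨isOpen_sUnion (h𝒱 n).1, hA𝒱 n⟩,
    iInter_sUnion_mem_zeroIndSets h𝒱 fun n V hV => ?_⟩
  obtain ⟨U, hU, hVU⟩ := hr n V hV
  exact (Metric.ediam_mono hVU).trans_lt hU.2

theorem mem_zeroIndSets_of_subsingleton {X : Type*} [TopologicalSpace X] {A : Set X}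
    (hA : A.Subsingleton) : A ∈ zeroIndSets X := by
  have := hA.coe_sort
  refine hasSmallInductiveDimensionLE_zero_of_nhds fun y U hy _ =>
    ⟨univ, isClopen_univ, mem_univ y, fun z _ => Subsingleton.elim y z ▸ hy⟩

end ZeroDim

/-! ### Separable metric spaces are strongly paracompact -/

/-- A countable subcover `U` gives an exhaustion `W n ⊆ F n ⊆ W (n + 1)`, in which `W n` meets only
the sets `U i` with `i < n` that cover it. Cutting `X` into layers that overlap only when adjacent,
and using finitely many `U i` on each, makes the refinement star-finite. -/
theorem stronglyParacompact_of_separableSpace (X : Type*) [MetricSpace X]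
    [TopologicalSpace.SeparableSpace X] : StronglyParacompact X := by
  have := UniformSpace.secondCountable_of_separable X
  rintro 𝒰 ⟨hO, hc⟩
  rcases isEmpty_or_nonempty X with hX | ⟨⟨x₀⟩⟩
  · exact ⟨∅, ⟨by simp, Subsingleton.elim _ _⟩, by simp [Refines], by simp⟩
  obtain ⟨T, hT, hTU, hTc⟩ := TopologicalSpace.isOpen_sUnion_countable 𝒰 hO
  rw [hc] at hTc
  obtain ⟨U, hU⟩ := hT.exists_eq_range (by
    obtain ⟨t, ht, -⟩ : x₀ ∈ ⋃₀ T := hTc ▸ mem_univ x₀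
    exact ⟨t, ht⟩)
  have hU𝒰 : ∀ i, U i ∈ 𝒰 := fun i => hTU (hU ▸ mem_range_self i)
  let F : ℕ → Set X := fun n => ⋃ i < n, {x | ((n : ENNReal))⁻¹ ≤ Metric.infEDist x (U i)ᶜ}
  let W : ℕ → Set X := fun n => ⋃ i < n, {x | ((n : ENNReal))⁻¹ < Metric.infEDist x (U i)ᶜ}
  have hF : ∀ n, IsClosed (F n) := fun n =>
    (finite_lt_nat n).isClosed_biUnion fun i _ =>
      isClosed_le continuous_const Metric.continuous_infEDist
  have hW : ∀ n, IsOpen (W n) := fun n => isOpen_biUnion fun i _ =>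
    isOpen_lt continuous_const Metric.continuous_infEDist
  have hWF : ∀ n, W n ⊆ F n := fun n => iUnion₂_mono fun i _ => ofPred_subset_ofPred.2 fun _ => le_of_lt
  have hFW : ∀ n, F n ⊆ W (n + 1) := by
    intro n x hx
    obtain ⟨i, hi, hx⟩ := mem_iUnion₂.1 hx
    refine mem_iUnion₂.2 ⟨i, Nat.lt_succ_of_lt hi, mem_ofPred.2 (lt_of_lt_of_le ?_ hx)⟩
    exact ENNReal.inv_lt_inv.2 (by exact_mod_cast Nat.lt_succ_self n)
  have hWmono : Monotone W := monotone_nat_of_le_succ fun n => (hWF n).trans (hFW n)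
  have hWc : ∀ x, ∃ n, x ∈ W n := by
    intro x
    obtain ⟨t, ht, hx⟩ : x ∈ ⋃₀ T := hTc ▸ mem_univ x
    obtain ⟨i, rfl⟩ := hU ▸ ht
    have hpos : 0 < Metric.infEDist x (U i)ᶜ := by
      rw [Metric.infEDist_pos_iff_notMem_closure,
        (hO _ (hU𝒰 i)).isClosed_compl.closure_eq]
      exact fun h => h hx
    obtain ⟨n, hn⟩ := ENNReal.exists_inv_nat_lt hpos.ne'
    refine ⟨max n (i + 1), mem_iUnion₂.2 ⟨i, by omega, mem_ofPred.2 (lt_of_le_of_lt ?_ hn)⟩⟩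
    exact ENNReal.inv_le_inv.2 (by exact_mod_cast le_max_left _ _)
  -- Truncated subtraction is harmless at `n = 0`, because `F 0` is empty.
  let L : ℕ → Set X := fun n => W (n + 1) \ F (n - 1)
  have hW0 : W 0 = ∅ := by simp [W]
  have hF0 : F 0 = ∅ := by simp [F]
  have hLd : ∀ n m, n + 2 ≤ m → Disjoint (L n) (L m) := fun n m hnm =>
    disjoint_left.2 fun x hx hx' => hx'.2 (hWF _ (hWmono (by omega) hx.1))
  refine ⟨{V | ∃ n, ∃ i < n + 1, V = L n ∩ U i}, ⟨?_, ?_⟩, ?_, ?_⟩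
  · rintro _ ⟨n, i, -, rfl⟩
    exact ((hW _).sdiff (hF _)).inter (hO _ (hU𝒰 i))
  · refine eq_univ_of_forall fun x => ?_
    classical
    have hx := hWc x
    obtain ⟨n, hn⟩ : ∃ n, Nat.find hx = n + 1 := by
      refine Nat.exists_eq_succ_of_ne_zero fun h0 => ?_
      have := Nat.find_spec hx
      rw [h0, hW0] at this
      exact this
    have hxW : x ∈ W (n + 1) := hn ▸ Nat.find_spec hx
    have hxF : x ∉ F (n - 1) := by
      cases n with
      | zero => simp [hF0]
      | succ k => exact fun h => Nat.find_min hx (by omega) (hFW _ h)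
    obtain ⟨i, hi, hxi⟩ := mem_iUnion₂.1 hxW
    refine ⟨_, ⟨n, i, hi, rfl⟩, ⟨hxW, hxF⟩, ?_⟩
    by_contra hxU
    have h0 : Metric.infEDist x (U i)ᶜ = 0 := Metric.infEDist_zero_of_mem hxU
    exact absurd hxi (by simp [h0])
  · rintro _ ⟨n, i, -, rfl⟩
    exact ⟨U i, hU𝒰 i, inter_subset_right⟩
  · rintro _ ⟨n, i, -, rfl⟩
    refine (((finite_lt_nat (n + 2)).prod (finite_lt_nat (n + 2))).image
      fun p : ℕ × ℕ => L p.1 ∩ U p.2).subset ?_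
    rintro _ ⟨⟨m, j, hj, rfl⟩, x, hx, hx'⟩
    have hm : m < n + 2 := by
      by_contra hm
      exact disjoint_left.1 (hLd n m (by omega)) hx.1 hx'.1
    exact ⟨(m, j), ⟨hm, show j < n + 2 by omega⟩, rfl⟩

/-! ### Plays and positions -/

section Plays

theorem initial_succ {α : Type*} (f : ℕ → α) (n : ℕ) :
    initial f (n + 1) = initial f n ++ [f n] := by
  simp [initial, List.range_succ]

theorem initial_getD {α : Type*} (p : List α) (d : α) :
    initial (fun k => p.getD k d) p.length = p := by
  apply List.ext_getElem <;> simp +contextual [initial]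

theorem TwoWinsMarkov.twoWins {M R : Type*} [Nonempty M] {G : Game M R} (h : TwoWinsMarkov G) :
    TwoWins G := by
  obtain ⟨σ, hσ⟩ := h
  obtain ⟨d⟩ := ‹Nonempty M›
  -- TWO replies to nonempty histories only, so `d` is never used; inning `n` has a history of
  -- length `n + 1`.
  refine ⟨fun p => σ (p.getLastD d) (p.length - 1), fun m hm => ?_⟩
  have : ∀ n, σ ((initial m (n + 1)).getLastD d) ((initial m (n + 1)).length - 1) =
      σ (m n) n := fun n => by
    rw [initial_succ]
    simp [initial]
  simp only [this]
  exact hσ m hm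

theorem OneWinsPre.oneWins {M R : Type*} {G : Game M R} (h : OneWinsPre G) : OneWins G := by
  obtain ⟨σ, hσ, hw⟩ := h
  have : ∀ (r : ℕ → R) n, (initial r n).length = n := fun r n => by simp [initial]
  refine ⟨fun p => σ p.length, fun r => ⟨fun n _ => hσ _, fun hr => hw r fun n => ?_⟩⟩
  simpa only [this] using hr n

/-- A reply of a winning strategy of TWO is legal. -/
theorem strategy_mem_replies {M R : Type*} {G : Game M R} {σ : List M → R}
    (hσ : ∀ m : ℕ → M, (∀ n, m n ∈ G.moves) → ∀ n, σ (initial m (n + 1)) ∈ G.replies (m n))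
    {p : List M} (hp : ∀ u ∈ p, u ∈ G.moves) {u : M} (hu : u ∈ G.moves) :
    σ (p ++ [u]) ∈ G.replies u := by
  have h := hσ (fun k => (p ++ [u]).getD k u) (fun n => by
    by_cases hn : n < (p ++ [u]).length
    · rw [List.getD_eq_getElem _ _ hn]
      rcases List.mem_append.1 (List.getElem_mem hn) with h | h
      · exact hp _ h
      · rw [List.mem_singleton.1 h]
        exact hu
    · rw [List.getD_eq_default _ _ (not_lt.1 hn)]
      exact hu) p.length
  rw [show p.length + 1 = (p ++ [u]).length by simp, initial_getD] at h
  simpa using h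

/-- Suppose that at each position satisfying an invariant `P` there are a set `Z ∈ 𝒵` and countably
many moves such that, for each `x ∉ Z`, one of these moves preserves `P` and is bad for `x`. Then
`X` is `σ`-`𝒵` or there is a play along which all moves are bad for some `x`. -/
theorem isSigma_or_exists_play {X M : Type*} [TopologicalSpace X] {𝒵 : Set (Set X)}
    (P : List M → Prop) (B : X → List M → M → Prop) (h0 : P [])
    (h : ∀ p, P p → ∃ Z ∈ 𝒵, ∃ next : ℕ → M, ∀ x ∉ Z, ∃ i, P (p ++ [next i]) ∧ B x p (next i)) :
    IsSigma 𝒵 ∨ ∃ (x : X) (m : ℕ → M), ∀ n, P (initial m n) ∧ B x (initial m n) (m n) := by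
  have h' : ∀ p, ∃ Z ∈ 𝒵, ∃ next : ℕ → M, P p →
      ∀ x ∉ Z, ∃ i, P (p ++ [next i]) ∧ B x p (next i) := by
    intro p
    by_cases hp : P p
    · obtain ⟨Z, hZ, next, hn⟩ := h p hp
      exact ⟨Z, hZ, next, fun _ => hn⟩
    · obtain ⟨Z, hZ, next, -⟩ := h [] h0
      exact ⟨Z, hZ, next, fun hp' => absurd hp' hp⟩
  choose Z hZ next hnext using h'
  -- A list of indices, latest first, codes a node of the tree of continuations. There are countably
  -- many such lists.
  let pos : List ℕ → List M := List.foldr (fun i p => p ++ [next p i]) []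
  by_cases hcov : ∀ x, ∃ s, x ∈ Z (pos s)
  · left
    obtain ⟨e, he⟩ := exists_surjective_nat (List ℕ)
    refine ⟨fun n => Z (pos (e n)), fun n => hZ _, eq_univ_of_forall fun x => ?_⟩
    obtain ⟨s, hs⟩ := hcov x
    obtain ⟨n, rfl⟩ := he s
    exact mem_iUnion.2 ⟨n, hs⟩
  · right
    push Not at hcov
    obtain ⟨x, hx⟩ := hcov
    have hi : ∀ s, ∃ i, P (pos s) → P (pos (i :: s)) ∧ B x (pos s) (next (pos s) i) := by
      intro s
      by_cases hs : P (pos s)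
      · obtain ⟨i, hi⟩ := hnext (pos s) hs x (hx s)
        exact ⟨i, fun _ => hi⟩
      · exact ⟨0, fun h => absurd h hs⟩
    choose i hi using hi
    let s : ℕ → List ℕ := fun n => Nat.rec [] (fun _ t => i t :: t) n
    let m : ℕ → M := fun n => next (pos (s n)) (i (s n))
    have hm : ∀ n, initial m n = pos (s n) := fun n => by
      induction n with
      | zero => rfl
      | succ n ih =>
        rw [initial_succ, ih]
        rfl
    have hP : ∀ n, P (pos (s n)) := fun n => by
      induction n with
      | zero => exact h0
      | succ n ih => exact (hi (s n) ih).1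
    refine ⟨x, m, fun n => ?_⟩
    rw [hm]
    exact ⟨hP n, (hi (s n) (hP n)).2⟩

end Plays

/-! ### Winning strategies and `σ`-zero-dimensionality -/

section Strategies

variable {X : Type*} [MetricSpace X]

theorem fullDiamCovers_subset_diamCovers : fullDiamCovers X ⊆ diamCovers X := by
  rintro _ ⟨ε, hε, rfl⟩
  refine ⟨⟨fun U hU => hU.1, eq_univ_of_forall fun x => ?_⟩, ε, hε, fun U hU => hU.2⟩
  obtain ⟨U, hU, hx, hd⟩ := exists_isOpen_ediam_lt x hε
  exact ⟨U, ⟨hU, hd⟩, hx⟩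

theorem IsSigma.twoWinsMarkov_Gc {𝒵 : Set (Set X)} (h𝒵 : 𝒵 ⊆ zeroDimSets X) (h : IsSigma 𝒵) :
    TwoWinsMarkov (Gc (openCovers X)) := by
  obtain ⟨Z, hZ, hc⟩ := h
  choose! σ hσ using fun (n : ℕ) (𝒰 : Set (Set X)) (h𝒰 : 𝒰 ∈ openCovers X) =>
    exists_disjointOpenFamily_of_mem_zeroDimSets (h𝒵 (hZ n)) h𝒰
  refine ⟨fun 𝒰 n => σ n 𝒰, fun m hm =>
    ⟨fun n => ⟨(hσ n _ (hm n)).1, (hσ n _ (hm n)).2.1⟩, ⟨fun V hV => ?_, ?_⟩⟩⟩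
  · obtain ⟨n, hn⟩ := mem_iUnion.1 hV
    exact (hσ n _ (hm n)).1.1 V hn
  · refine eq_univ_of_forall fun x => ?_
    obtain ⟨n, hn⟩ := mem_iUnion.1 (hc ▸ mem_univ x : x ∈ ⋃ n, Z n)
    obtain ⟨V, hV, hx⟩ := (hσ n _ (hm n)).2.2 hn
    exact ⟨V, mem_iUnion.2 ⟨n, hV⟩, hx⟩

theorem TwoWins.Gc_mono {𝒜 ℬ : Set (Set (Set X))} (h : 𝒜 ⊆ ℬ) (hw : TwoWins (Gc ℬ)) :
    TwoWins (Gc 𝒜) := by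
  obtain ⟨σ, hσ⟩ := hw
  exact ⟨σ, fun m hm => hσ m fun n => h (hm n)⟩

theorem TwoWinsMarkov.Gc_mono {𝒜 ℬ : Set (Set (Set X))} (h : 𝒜 ⊆ ℬ)
    (hw : TwoWinsMarkov (Gc ℬ)) : TwoWinsMarkov (Gc 𝒜) := by
  obtain ⟨σ, hσ⟩ := hw
  exact ⟨σ, fun m hm => hσ m fun n => h (hm n)⟩

theorem haverGame_replies_of_Gc {𝒜 : Set (Set (Set X))} {ε : ℝ} {𝒱 : Set (Set X)}
    (h : 𝒱 ∈ (Gc 𝒜).replies {U | IsOpen U ∧ Metric.ediam U < ENNReal.ofReal ε}) :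
    𝒱 ∈ (haverGame X).replies ε := by
  refine ⟨h.1, fun V hV => ?_⟩
  obtain ⟨U, hU, hVU⟩ := h.2 V hV
  exact (Metric.ediam_mono hVU).trans_lt hU.2

theorem TwoWins.haverGame (hw : TwoWins (Gc (fullDiamCovers X))) : TwoWins (haverGame X) := by
  obtain ⟨σ, hσ⟩ := hw
  let g : ℝ → Set (Set X) := fun ε => {U | IsOpen U ∧ Metric.ediam U < ENNReal.ofReal ε}
  refine ⟨fun p => σ (p.map g), fun m hm => ?_⟩
  have h := hσ (fun n => g (m n)) fun n => ⟨m n, hm n, rfl⟩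
  have hmap : ∀ n, (initial m n).map g = initial (fun n => g (m n)) n := fun n => by
    simp [initial]
  simp only [hmap]
  exact ⟨fun n => haverGame_replies_of_Gc (h.1 n), h.2⟩

theorem TwoWinsMarkov.haverGame (hw : TwoWinsMarkov (Gc (fullDiamCovers X))) :
    TwoWinsMarkov (haverGame X) := by
  obtain ⟨σ, hσ⟩ := hw
  let g : ℝ → Set (Set X) := fun ε => {U | IsOpen U ∧ Metric.ediam U < ENNReal.ofReal ε}
  refine ⟨fun ε n => σ (g ε) n, fun m hm => ?_⟩
  have h := hσ (fun n => g (m n)) fun n => ⟨m n, hm n, rfl⟩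
  exact ⟨fun n => haverGame_replies_of_Gc (h.1 n), h.2⟩

/-- After a position `p`, let ONE try every `1 / (n + 1)`. The points covered by all the replies
form a set with `ind ≤ 0`, and any other point is missed by some reply. -/
theorem TwoWins.isSigma_of_haverGame (hw : TwoWins (TopGames.haverGame X)) :
    IsSigma (zeroIndSets X) := by
  obtain ⟨σ, hσ⟩ := hw
  refine (isSigma_or_exists_play (M := ℝ) (fun p => ∀ ε ∈ p, 0 < ε)
    (fun x p ε => x ∉ ⋃₀ σ (p ++ [ε])) (by simp) fun p hp => ?_).resolve_right ?_
  · have hpos : ∀ n : ℕ, (0 : ℝ) < 1 / (n + 1) := fun n => by positivity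
    have hrep := fun n => strategy_mem_replies (fun m hm => (hσ m hm).1) hp (hpos n)
    refine ⟨_, iInter_sUnion_mem_zeroIndSets (fun n => (hrep n).1) fun n => (hrep n).2,
      fun n : ℕ => 1 / ((n : ℝ) + 1), fun x hx => ?_⟩
    obtain ⟨n, hn⟩ := not_forall.1 (mt mem_iInter.2 hx)
    refine ⟨n, fun ε hε => ?_, hn⟩
    rcases List.mem_append.1 hε with h | h
    · exact hp _ h
    · exact List.mem_singleton.1 h ▸ hpos n
  · rintro ⟨x, m, hm⟩
    have hmoves : ∀ n, 0 < m n := fun n => (hm (n + 1)).1 _ (by simp [initial_succ])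
    obtain ⟨V, hV, hx⟩ : x ∈ ⋃₀ ⋃ n, σ (initial m (n + 1)) := (hσ m hmoves).2.2 ▸ mem_univ x
    obtain ⟨n, hn⟩ := mem_iUnion.1 hV
    exact (hm n).2 ⟨V, initial_succ m n ▸ hn, hx⟩

theorem IsSigma.twoWinsMarkov_G₁ {𝒵 : Set (Set X)} (h : IsSigma 𝒵) :
    TwoWinsMarkov (G₁ (coversOf 𝒵) (openCovers X)) := by
  obtain ⟨Z, hZ, hc⟩ := h
  choose! σ hσ hZσ using fun (n : ℕ) (𝒰 : Set (Set X)) (h𝒰 : 𝒰 ∈ coversOf 𝒵) =>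
    h𝒰.2.2 (Z n) (hZ n)
  refine ⟨fun 𝒰 n => σ n 𝒰, fun m hm => ⟨fun n => hσ n _ (hm n), ?_, ?_⟩⟩
  · rintro _ ⟨n, rfl⟩
    exact (hm n).1.1 _ (hσ n _ (hm n))
  · refine eq_univ_of_forall fun x => ?_
    obtain ⟨n, hn⟩ := mem_iUnion.1 (hc ▸ mem_univ x : x ∈ ⋃ n, Z n)
    exact ⟨_, ⟨n, rfl⟩, hZσ n _ (hm n) hn⟩

theorem IsSigma.oneWinsPre {𝒵 : Set (Set X)} (h : IsSigma 𝒵) :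
    OneWinsPre (G₁ (nbhdsOf 𝒵) (openCovers X)ᶜ) := by
  obtain ⟨Z, hZ, hc⟩ := h
  refine ⟨fun n => {U | IsOpen U ∧ Z n ⊆ U}, fun n => ⟨Z n, hZ n, rfl⟩, fun r hr hw => hw ?_⟩
  refine ⟨?_, eq_univ_of_forall fun x => ?_⟩
  · rintro _ ⟨n, rfl⟩
    exact (hr n).1
  · obtain ⟨n, hn⟩ := mem_iUnion.1 (hc ▸ mem_univ x : x ∈ ⋃ n, Z n)
    exact ⟨_, ⟨n, rfl⟩, (hr n).2 hn⟩

theorem TwoWins.isSigma_of_G₁ (h𝒵 : zeroDimSets X = zeroIndSets X)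
    (hw : TwoWins (G₁ (coversOf (zeroIndSets X)) (openCovers X))) : IsSigma (zeroIndSets X) := by
  obtain ⟨σ, hσ⟩ := hw
  refine (isSigma_or_exists_play (M := Set (Set X))
    (fun p => ∀ 𝒰 ∈ p, 𝒰 ∈ coversOf (zeroIndSets X))
    (fun x p 𝒰 => x ∉ σ (p ++ [𝒰])) (by simp) fun p hp => ?_).resolve_right ?_
  -- Otherwise each `A` has a proper open neighbourhood that `σ` never selects after `p`. These
  -- neighbourhoods form a legal move, from which `σ` must select one of them.
  · obtain ⟨A, hA, hAσ⟩ : ∃ A ∈ zeroIndSets X, ∀ U, IsOpen U → A ⊆ U → U ≠ univ →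
        ∃ 𝒰 ∈ coversOf (zeroIndSets X), σ (p ++ [𝒰]) = U := by
      by_contra! hcon
      choose! U hUo hAU hUne hU using hcon
      have hmem : U '' zeroIndSets X ∈ coversOf (zeroIndSets X) := by
        refine ⟨⟨?_, eq_univ_of_forall fun x => ?_⟩, ?_, fun A hA => ⟨_, ⟨A, hA, rfl⟩, hAU A hA⟩⟩
        · rintro _ ⟨A, hA, rfl⟩
          exact hUo A hA
        · have hx := mem_zeroIndSets_of_subsingleton (subsingleton_singleton (a := x))
          exact ⟨_, ⟨_, hx, rfl⟩, hAU _ hx rfl⟩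
        · rintro ⟨A, hA, h⟩
          exact hUne A hA h
      obtain ⟨A, hA, h⟩ := strategy_mem_replies (fun m hm => (hσ m hm).1) hp hmem
      exact hU A hA _ hmem h.symm
    obtain ⟨U, hU, hUZ⟩ := exists_iInter_mem_zeroIndSets (h𝒵 ▸ hA)
    -- When `U n` is all of `X` it misses no point, so that index is never followed and an arbitrary
    -- value will do.
    have hnext : ∀ n, ∃ 𝒰, U n ≠ univ → 𝒰 ∈ coversOf (zeroIndSets X) ∧ σ (p ++ [𝒰]) = U n := by
      intro n
      by_cases hn : U n = univ
      · exact ⟨∅, fun h => absurd hn h⟩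
      · obtain ⟨𝒰, h𝒰⟩ := hAσ (U n) (hU n).1 (hU n).2 hn
        exact ⟨𝒰, fun _ => h𝒰⟩
    choose next hnext using hnext
    refine ⟨_, hUZ, next, fun x hx => ?_⟩
    obtain ⟨n, hn⟩ := not_forall.1 (mt mem_iInter.2 hx)
    obtain ⟨h1, h2⟩ := hnext n fun h => hn (h ▸ mem_univ x)
    refine ⟨n, fun 𝒰 h𝒰 => ?_, h2 ▸ hn⟩
    rcases List.mem_append.1 h𝒰 with h | h
    · exact hp _ h
    · exact List.mem_singleton.1 h ▸ h1
  · rintro ⟨x, m, hm⟩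
    have hmoves : ∀ n, m n ∈ coversOf (zeroIndSets X) :=
      fun n => (hm (n + 1)).1 _ (by simp [initial_succ])
    obtain ⟨_, ⟨n, rfl⟩, hx⟩ : x ∈ ⋃₀ range fun n => σ (initial m (n + 1)) :=
      (hσ m hmoves).2.2 ▸ mem_univ x
    exact (hm n).2 (initial_succ m n ▸ hx)

theorem OneWins.isSigma (h𝒵 : zeroDimSets X = zeroIndSets X)
    (hw : OneWins (G₁ (nbhdsOf (zeroIndSets X)) (openCovers X)ᶜ)) : IsSigma (zeroIndSets X) := by
  obtain ⟨σ, hσ⟩ := hw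
  refine (isSigma_or_exists_play (M := Set X)
    -- Here positions are lists of TWO's replies, and the invariant says that all of them were legal
    -- against `σ`. It forces the next move of `σ` to be the neighbourhood family of some `A`, so
    -- TWO may reply with any term of a sequence of open sets whose intersection is a
    -- zero-dimensional `Gδ` hull of `A`.
    (fun p => ∀ q u, q ++ [u] <+: p → u ∈ σ q)
    (fun x _ u => x ∉ u) (by simp) fun p hp => ?_).resolve_right ?_
  · obtain ⟨A, hA, hσA⟩ : σ p ∈ nbhdsOf (zeroIndSets X) := by
      have hr := (hσ fun k => p.getD k ∅).1 p.length fun k hk => ?_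
      · rwa [initial_getD] at hr
      · refine hp _ _ ?_
        rw [← initial_succ]
        conv_rhs => rw [← initial_getD p ∅]
        have hk' : List.range (k + 1) = (List.range p.length).take (k + 1) := by
          rw [List.take_range, min_eq_left (Nat.succ_le_of_lt hk)]
        rw [initial, hk']
        exact (List.take_prefix _ _).map _
    obtain ⟨U, hU, hUZ⟩ := exists_iInter_mem_zeroIndSets (h𝒵 ▸ hA)
    refine ⟨_, hUZ, U, fun x hx => ?_⟩
    obtain ⟨n, hn⟩ := not_forall.1 (mt mem_iInter.2 hx)
    refine ⟨n, fun q u hq => ?_, hn⟩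
    rcases List.prefix_concat_iff.1 hq with h | h
    · obtain ⟨rfl, hu⟩ := List.append_inj' h rfl
      rw [List.singleton_inj.1 hu, hσA]
      exact hU n
    · exact hp q u h
  · rintro ⟨x, m, hm⟩
    have hmoves : ∀ n, m n ∈ σ (initial m n) :=
      fun n => (hm (n + 1)).1 _ _ (by rw [initial_succ])
    have hc : range m ∈ openCovers X := not_not.1 ((hσ m).2 hmoves)
    obtain ⟨_, ⟨n, rfl⟩, hx⟩ : x ∈ ⋃₀ range m := hc.2 ▸ mem_univ x
    exact (hm n).2 hx

end Strategies

end TopGames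

theorem mainTheorem3 (X : Type*) [MetricSpace X] :
    (TopologicalSpace.SeparableSpace X → TopGames.StronglyParacompact X) ∧
    (TopGames.StronglyParacompact X →
      ∀ 𝒵 : Set (Set X), (𝒵 = TopGames.zeroDimSets X ∨ 𝒵 = TopGames.zeroIndSets X) →
      ∀ 𝒪diam : Set (Set (Set X)),
        (𝒪diam = TopGames.diamCovers X ∨ 𝒪diam = TopGames.fullDiamCovers X) →
      List.TFAE [
        TopGames.IsSigma 𝒵,
        TopGames.TwoWins (TopGames.haverGame X),
        TopGames.TwoWinsMarkov (TopGames.haverGame X),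
        TopGames.TwoWins (TopGames.Gc (TopGames.openCovers X)),
        TopGames.TwoWinsMarkov (TopGames.Gc (TopGames.openCovers X)),
        TopGames.TwoWins (TopGames.Gc 𝒪diam),
        TopGames.TwoWinsMarkov (TopGames.Gc 𝒪diam),
        TopGames.TwoWins (TopGames.G₁ (TopGames.coversOf 𝒵) (TopGames.openCovers X)),
        TopGames.TwoWinsMarkov (TopGames.G₁ (TopGames.coversOf 𝒵) (TopGames.openCovers X)),
        TopGames.OneWins (TopGames.G₁ (TopGames.nbhdsOf 𝒵) (TopGames.openCovers X)ᶜ),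
        TopGames.OneWinsPre (TopGames.G₁ (TopGames.nbhdsOf 𝒵) (TopGames.openCovers X)ᶜ)]) := by
  refine ⟨fun _ => TopGames.stronglyParacompact_of_separableSpace X,
    fun hX 𝒵 h𝒵 𝒪diam h𝒪 => ?_⟩
  have heq := hX.zeroDimSets_eq_zeroIndSets
  obtain rfl : 𝒵 = TopGames.zeroIndSets X := h𝒵.elim (fun h => h.trans heq) id
  have h1 : 𝒪diam ⊆ TopGames.openCovers X := by
    rcases h𝒪 with rfl | rfl
    · exact fun 𝒰 h => h.1
    · exact fun 𝒰 h => (TopGames.fullDiamCovers_subset_diamCovers h).1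
  have h2 : TopGames.fullDiamCovers X ⊆ 𝒪diam := by
    rcases h𝒪 with rfl | rfl
    · exact TopGames.fullDiamCovers_subset_diamCovers
    · exact Set.Subset.rfl
  tfae_have 1 → 5 := fun h => h.twoWinsMarkov_Gc heq.ge
  tfae_have 5 → 4 := fun h => h.twoWins
  tfae_have 5 → 7 := fun h => h.Gc_mono h1
  tfae_have 4 → 6 := fun h => h.Gc_mono h1
  tfae_have 7 → 6 := fun h => h.twoWins
  tfae_have 7 → 3 := fun h => (h.Gc_mono h2).haverGame
  tfae_have 6 → 2 := fun h => (h.Gc_mono h2).haverGame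
  tfae_have 3 → 2 := fun h => h.twoWins
  tfae_have 2 → 1 := fun h => h.isSigma_of_haverGame
  tfae_have 1 → 9 := fun h => h.twoWinsMarkov_G₁
  tfae_have 9 → 8 := fun h => h.twoWins
  tfae_have 8 → 1 := fun h => h.isSigma_of_G₁ heq
  tfae_have 1 → 11 := fun h => h.oneWinsPre
  tfae_have 11 → 10 := fun h => h.oneWins
  tfae_have 10 → 1 := fun h => h.isSigma heq
  tfae_finish
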